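/- For real numbers $\theta,\varphi$ define the inhomogeneous approximation constant $$L(\theta,\varphi)=\liminf_{|q|\to\infty}\,|q|\,\|q\theta-\varphi\|\in[0,\infty],$$ where $q$ ranges over all integers (positive and negative) and $\|x\|$ denotes the distance from $x$ to the nearest integer. Let $s\ge 1$ and $n\ge 2$ be integers, let $\theta=e^{1/s}$, and let $m,r$ be integers. If $$L\bigl(\theta,(m+r\theta)/n\bigr)=0,\qquad\text{then}\qquad L\bigl(\theta,(m-r\theta)/n\bigr)=0.$$ -/

import Mathlib

/-- `‖x‖`: the distance from the real number `x` to the nearest integer. -/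
noncomputable def distNearestInt (x : ℝ) : ℝ :=
  |x - (round x : ℝ)|

/-- The inhomogeneous approximation constant
`L(θ, φ) = liminf_{|q| → ∞} |q| ‖q θ - φ‖`, where `q` runs over all (positive and negative)
integers. It is an extended real number, so that the value `∞` (which occurs for rational `θ`)
is represented faithfully. The filter is `|q| → ∞`. -/
noncomputable def inhomApproxConst (θ φ : ℝ) : EReal :=
  Filter.liminf
    (fun q : ℤ => ((|(q : ℝ)| * distNearestInt ((q : ℝ) * θ - φ) : ℝ) : EReal))
    (Filter.comap (fun q : ℤ => |q|) Filter.atTop)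

open Filter

/-! Multiplying by `n`, the constant at `(m + rθ)/n` vanishes iff `|Q| |Qθ - P|` gets arbitrarily
small over `P ≡ m`, `Q ≡ -r` mod `n` with `|Q|` large. For `θ = e^{1/s}` a single pair with `Q ≠ 0`
and value at most 1/16 is a multiple `k (p_i, q_i)` of a diagonal Padé approximant
(`eq_mul_pade_of_good_approx`). The recurrence coefficient `(4i + 2)s` changes sign under `i ↦ -1 -
i`, and the sequences mod `n` are purely periodic; so arbitrarily late indices `l` have `p_l ≡ p_i`,
`q_l ≡ -q_i` (`exists_pade_reflect`). The pairs `k (p_l, q_l)` then lie in the class `(m, r)`, and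
their values tend to 0 because `q_{l+1} / q_l` is unbounded. -/

/-- Solutions of `x (i + 2) = (4 i + 2) s x (i + 1) + x i` with `x 0 = a` and `x 1 = b`. -/
def padeSeq {R : Type*} [CommRing R] (s : ℕ) (a b : R) : ℕ → R
  | 0 => a
  | 1 => b
  | i + 2 => (4 * (i : R) + 2) * s * padeSeq s a b (i + 1) + padeSeq s a b i

/-- Numerators of the diagonal Padé approximants of `exp (1 / s)`, shifted by one. -/
def padeNum (s : ℕ) : ℕ → ℤ := padeSeq s 1 1

/-- Denominators of the diagonal Padé approximants of `exp (1 / s)`, shifted by one. -/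
def padeDen (s : ℕ) : ℕ → ℤ := padeSeq s (-1) 1

lemma padeSeq_succ_succ {R : Type*} [CommRing R] (s : ℕ) (a b : R) (i : ℕ) :
    padeSeq s a b (i + 2)
      = (4 * (i : R) + 2) * s * padeSeq s a b (i + 1) + padeSeq s a b i := rfl

lemma padeNum_succ_succ (s i : ℕ) :
    padeNum s (i + 2) = (4 * (i : ℤ) + 2) * s * padeNum s (i + 1) + padeNum s i := rfl

lemma padeDen_succ_succ (s i : ℕ) :
    padeDen s (i + 2) = (4 * (i : ℤ) + 2) * s * padeDen s (i + 1) + padeDen s i := rfl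

lemma map_padeSeq {R S : Type*} [CommRing R] [CommRing S] (f : R →+* S) (s : ℕ) (a b : R)
    (i : ℕ) : f (padeSeq s a b i) = padeSeq s (f a) (f b) i := by
  induction i using Nat.twoStepInduction with
  | zero => rfl
  | one => rfl
  | more i h0 h1 => simp [padeSeq_succ_succ, h0, h1, map_ofNat f]

/-! ### Periodicity and reflection modulo `n` -/

/-- One step of the recurrence modulo `n` for two sequences at once, together with the index. -/
def padeStep (n s : ℕ) (x : ZMod n × (ZMod n × ZMod n) × (ZMod n × ZMod n)) :
    ZMod n × (ZMod n × ZMod n) × (ZMod n × ZMod n) :=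
  (x.1 + 1, (x.2.1.2, (4 * x.1 + 2) * s * x.2.1.2 + x.2.1.1),
    (x.2.2.2, (4 * x.1 + 2) * s * x.2.2.2 + x.2.2.1))

/-- The coefficient of the oldest term is 1, so the recurrence runs backwards over any ring. On a
finite state space this gives pure periodicity; the index is part of the state to make the step
autonomous. -/
lemma padeStep_injective (n s : ℕ) : Function.Injective (padeStep n s) := by
  rintro ⟨t, ⟨a, b⟩, ⟨c, d⟩⟩ ⟨t', ⟨a', b'⟩, ⟨c', d'⟩⟩ h
  simp only [padeStep, Prod.mk.injEq, add_left_inj] at h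
  obtain ⟨rfl, ⟨rfl, h1⟩, rfl, h2⟩ := h
  simp only [add_right_inj] at h1 h2
  rw [h1, h2]

lemma padeStep_iterate (n s : ℕ) (a b c d : ZMod n) (i : ℕ) :
    (padeStep n s)^[i] (0, (a, b), (c, d))
      = ((i : ZMod n), (padeSeq s a b i, padeSeq s a b (i + 1)),
          (padeSeq s c d i, padeSeq s c d (i + 1))) := by
  induction i with
  | zero => simp [padeSeq]
  | succ i ih =>
    rw [Function.iterate_succ_apply', ih]
    simp [padeStep, padeSeq_succ_succ]

lemma exists_pade_period (n s : ℕ) [NeZero n] (a b c d : ZMod n) :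
    ∃ T : ℕ, 0 < T ∧ ∀ M : ℕ, ((M * T : ℕ) : ZMod n) = 0 ∧
      padeSeq s a b (M * T) = a ∧ padeSeq s a b (M * T + 1) = b ∧
      padeSeq s c d (M * T) = c ∧ padeSeq s c d (M * T + 1) = d := by
  obtain ⟨T, hT, h⟩ := (padeStep_injective n s).mem_periodicPts (0, (a, b), (c, d))
  refine ⟨T, hT, fun M => ?_⟩
  have h' := h.const_mul M
  rw [Function.IsPeriodicPt, Function.IsFixedPt, padeStep_iterate] at h'
  simp only [Prod.mk.injEq] at h'
  obtain ⟨h1, ⟨h2, h3⟩, h4, h5⟩ := h'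
  exact ⟨h1, h2, h3, h4, h5⟩

lemma padeSeq_reflect {n s : ℕ} {a b e : ZMod n} {N : ℕ} (hN : (N : ZMod n) = 0)
    (h0 : padeSeq s a b (N + 1) = e * a) (h1 : padeSeq s a b N = e * b) (i : ℕ) :
    ∀ l, l + i = N + 1 → padeSeq s a b l = e * padeSeq s a b i := by
  induction i using Nat.twoStepInduction with
  | zero => rintro l rfl; exact h0
  | one =>
    intro l hl
    obtain rfl : l = N := by omega
    exact h1
  | more i ih0 ih1 =>
    intro l hl
    have e0 := ih0 (l + 2) (by omega)
    have e1 := ih1 (l + 1) (by omega)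
    -- Hence `4l + 2 ≡ -(4i + 2)`: the recurrence read backwards from `N + 1` is the original one.
    have hc : ((l : ZMod n)) + i + 1 = 0 := by
      have : l + i + 1 = N := by omega
      rw [← hN, ← this]; push_cast; ring
    have hr := padeSeq_succ_succ s a b l
    rw [padeSeq_succ_succ, mul_add, ← e0, hr, e1]
    linear_combination (-4 * (s : ZMod n) * e * padeSeq s a b (i + 1)) * hc

lemma exists_pade_reflect (n s : ℕ) [NeZero n] (i B : ℕ) :
    ∃ l, B ≤ l ∧ (padeNum s l : ZMod n) = padeNum s i ∧
      (padeDen s l : ZMod n) = -padeDen s i := by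
  obtain ⟨T, hT, h⟩ := exists_pade_period n s (1 : ZMod n) 1 (-1) 1
  -- With `B + i` periods the reflected index `(B + i) * T + 1 - i` is at least `B`.
  obtain ⟨h0, h1, h2, h3, h4⟩ := h (B + i)
  have hle : B + i ≤ (B + i) * T := Nat.le_mul_of_pos_right _ hT
  have key : ∀ (a b : ℤ) (j : ℕ),
      ((padeSeq s a b j : ℤ) : ZMod n) = padeSeq s (a : ZMod n) (b : ZMod n) j :=
    fun a b j => map_padeSeq (Int.castRingHom (ZMod n)) s a b j
  refine ⟨(B + i) * T + 1 - i, by omega, ?_, ?_⟩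
  · have := padeSeq_reflect (e := 1) h0 (by rw [h2, one_mul]) (by rw [h1, one_mul]) i
      ((B + i) * T + 1 - i) (by omega)
    rw [padeNum, key, key]
    simpa using this
  · have := padeSeq_reflect (e := -1) h0 (by rw [h4]; ring) (by rw [h3]; ring) i
      ((B + i) * T + 1 - i) (by omega)
    rw [padeDen, key, key]
    simpa using this

/-! ### Arithmetic of the approximants -/

lemma padeNum_odd (s i : ℕ) : Odd (padeNum s i) := by
  induction i using Nat.twoStepInduction with
  | zero => exact odd_one
  | one => exact odd_one
  | more i h0 h1 =>
    rw [padeNum_succ_succ]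
    refine Even.add_odd ?_ h0
    exact ⟨(2 * (i : ℤ) + 1) * s * padeNum s (i + 1), by ring⟩

lemma pade_det (s i : ℕ) :
    padeDen s (i + 1) * padeNum s i - padeDen s i * padeNum s (i + 1) = 2 * (-1) ^ i := by
  induction i with
  | zero => norm_num [padeDen, padeNum, padeSeq]
  | succ i ih =>
    rw [padeDen_succ_succ, padeNum_succ_succ, pow_succ]
    linear_combination -ih

/-- The determinant `±2` leaves only 2 as a possible common prime, and the numerators are odd. -/
lemma pade_isCoprime (s i : ℕ) : IsCoprime (padeDen s i) (padeNum s i) := by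
  obtain ⟨t, ht⟩ := padeNum_odd s i
  have hd := pade_det s i
  have hs : ((-1 : ℤ) ^ i) * (-1) ^ i = 1 := by rw [← mul_pow]; simp
  refine ⟨t * (-1) ^ i * padeNum s (i + 1), 1 - t * (-1) ^ i * padeDen s (i + 1), ?_⟩
  linear_combination ht - t * (-1) ^ i * hd - 2 * t * hs

lemma padeDen_pos {s : ℕ} (hs : 1 ≤ s) (i : ℕ) : 1 ≤ padeDen s (i + 1) := by
  have hs' : (1 : ℤ) ≤ s := by exact_mod_cast hs
  induction i using Nat.twoStepInduction with
  | zero => simp [padeDen, padeSeq]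
  | one => simp [padeDen, padeSeq]; omega
  | more i h0 h1 =>
    rw [padeDen_succ_succ]
    have : 0 ≤ (4 * ((i + 1 : ℕ) : ℤ) + 2) * s * padeDen s (i + 1 + 1) := by positivity
    linarith

lemma padeDen_growth {s : ℕ} (hs : 1 ≤ s) (i : ℕ) :
    (i + 1 : ℤ) * padeDen s (i + 2) ≤ padeDen s (i + 3) := by
  have hs' : (1 : ℤ) ≤ s := by exact_mod_cast hs
  have h0 := padeDen_pos hs i
  have h1 := padeDen_pos hs (i + 1)
  have hrec := padeDen_succ_succ s (i + 1)
  have hc : (i + 1 : ℤ) ≤ (4 * ((i + 1 : ℕ) : ℤ) + 2) * s := by push_cast; nlinarith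
  have := mul_le_mul_of_nonneg_right hc (by linarith : 0 ≤ padeDen s (i + 1 + 1))
  linarith

lemma padeDen_large {s : ℕ} (hs : 1 ≤ s) (i : ℕ) : (i + 1 : ℤ) ≤ padeDen s (i + 3) := by
  have := padeDen_growth hs i
  have h1 := padeDen_pos hs (i + 1)
  nlinarith

/-! ### Approximation quality -/

/-- The coefficients `1 / ((2 k)‼ (2 k + 2 i - 1)‼)`; for `i = 0` they are those of `cosh`. -/
noncomputable def hypCoeff : ℕ → ℕ → ℝ
  | 0, k => 1 / (2 * k).factorial
  | i + 1, k => hypCoeff i k / (2 * k + 2 * i + 1)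

lemma hypCoeff_pos (i k : ℕ) : 0 < hypCoeff i k := by
  induction i with
  | zero => simp only [hypCoeff]; positivity
  | succ i ih => simp only [hypCoeff]; positivity

lemma hypCoeff_le (i k : ℕ) : hypCoeff i k ≤ 1 / (2 * k).factorial := by
  induction i with
  | zero => exact le_rfl
  | succ i ih =>
    refine le_trans (div_le_self (hypCoeff_pos i k).le ?_) ih
    have : (0 : ℝ) ≤ 2 * k + 2 * i := by positivity
    linarith

/-- The factor `(2k + 2i - 1)‼` depends only on `k + i`, so trading one `i` for one `k` changes only
`(2k)‼`. -/
lemma hypCoeff_succ_right (i k : ℕ) :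
    hypCoeff i (k + 1) * (2 * k + 2) = hypCoeff (i + 1) k := by
  induction i with
  | zero =>
    simp only [hypCoeff]
    have : (2 * (k + 1)).factorial = (2 * k + 2) * ((2 * k + 1) * (2 * k).factorial) := by
      rw [show 2 * (k + 1) = 2 * k + 1 + 1 by ring, Nat.factorial_succ, Nat.factorial_succ]
    rw [this]
    push_cast
    have : ((2 * k).factorial : ℝ) ≠ 0 := by positivity
    field_simp
    ring
  | succ i ih =>
    rw [hypCoeff, hypCoeff, ← ih]
    push_cast
    have h1 : (2 * ((k : ℝ) + 1) + 2 * i + 1) ≠ 0 := by positivity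
    have h2 : (2 * (k : ℝ) + 2 * (i + 1) + 1) ≠ 0 := by positivity
    field_simp
    ring

/-- The sums of the series with coefficients `hypCoeff i`, in the variable `h ^ 2`. -/
noncomputable def hypSum (h : ℝ) (i : ℕ) : ℝ := ∑' k, hypCoeff i k * h ^ (2 * k)

lemma summable_hypCoeff (h : ℝ) (i : ℕ) : Summable fun k => hypCoeff i k * h ^ (2 * k) := by
  refine Summable.of_nonneg_of_le (fun k => ?_) (fun k => ?_) (Real.hasSum_cosh h).summable
  · rw [pow_mul]; exact mul_nonneg (hypCoeff_pos i k).le (by positivity)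
  · rw [pow_mul, div_eq_mul_one_div, mul_comm]
    exact mul_le_mul_of_nonneg_left (hypCoeff_le i k) (by positivity)

lemma hypSum_pos (h : ℝ) (i : ℕ) : 0 < hypSum h i := by
  refine (summable_hypCoeff h i).tsum_pos (fun k => ?_) 0 ?_
  · rw [pow_mul]; exact mul_nonneg (hypCoeff_pos i k).le (by positivity)
  · simpa using hypCoeff_pos i 0

lemma hypSum_zero (h : ℝ) : hypSum h 0 = Real.cosh h := by
  rw [← (Real.hasSum_cosh h).tsum_eq]
  exact tsum_congr fun k => by rw [hypCoeff]; ring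

lemma hypSum_one (h : ℝ) : h * hypSum h 1 = Real.sinh h := by
  rw [← (Real.hasSum_sinh h).tsum_eq, hypSum, ← tsum_mul_left]
  refine tsum_congr fun k => ?_
  rw [hypCoeff, hypCoeff, Nat.factorial_succ]
  push_cast
  have h1 : ((2 * k).factorial : ℝ) ≠ 0 := by positivity
  have h2 : (2 * (k : ℝ) + 1) ≠ 0 := by positivity
  simp only [mul_zero, add_zero]
  field_simp
  ring

lemma hypSum_rec (h : ℝ) (i : ℕ) :
    h ^ 2 * hypSum h (i + 2) = hypSum h i - (2 * i + 1) * hypSum h (i + 1) := by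
  have hz : hypCoeff i 0 = (2 * i + 1) * hypCoeff (i + 1) 0 := by
    rw [hypCoeff]
    have h1 : (2 * (i : ℝ) + 1) ≠ 0 := by positivity
    push_cast
    simp only [mul_zero, zero_add]
    field_simp
  have hk : ∀ k, hypCoeff i (k + 1) - (2 * i + 1) * hypCoeff (i + 1) (k + 1)
      = hypCoeff (i + 2) k := by
    intro k
    rw [← hypCoeff_succ_right (i + 1) k, hypCoeff]
    push_cast
    have h1 : (2 * ((k : ℝ) + 1) + 2 * i + 1) ≠ 0 := by positivity
    field_simp
    ring
  rw [hypSum, hypSum, hypSum, (summable_hypCoeff h i).tsum_eq_zero_add,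
    (summable_hypCoeff h (i + 1)).tsum_eq_zero_add, hz, mul_add, ← tsum_mul_left, ← tsum_mul_left]
  have h0 := (summable_nat_add_iff 1).2 (summable_hypCoeff h i)
  have h1 := ((summable_nat_add_iff 1).2 (summable_hypCoeff h (i + 1))).mul_left (2 * (i : ℝ) + 1)
  have h2 := h0.tsum_sub h1
  have h3 : ∑' k, h ^ 2 * (hypCoeff (i + 2) k * h ^ (2 * k))
      = ∑' k, (hypCoeff i (k + 1) * h ^ (2 * (k + 1))
        - (2 * (i : ℝ) + 1) * (hypCoeff (i + 1) (k + 1) * h ^ (2 * (k + 1)))) :=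
    tsum_congr fun k => by rw [← hk]; ring
  rw [h3, h2]
  simp only [mul_zero, pow_zero, mul_one]
  ring

/-- With `h = 1/(2s)`, both sides satisfy the same recurrence by `hypSum_rec` and `2sh = 1`,
starting from `-2 cosh h` and `2 sinh h`. Positivity of `hypSum` then makes the errors alternate in
sign. -/
lemma pade_remainder {s : ℕ} (hs : 1 ≤ s) (i : ℕ) :
    padeDen s i * Real.exp (1 / (2 * s : ℝ)) - padeNum s i * Real.exp (-(1 / (2 * s : ℝ)))
      = (-1) ^ (i + 1) * (2 * (1 / (2 * s : ℝ)) ^ i * hypSum (1 / (2 * s : ℝ)) i) := by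
  have hs' : (s : ℝ) ≠ 0 := by positivity
  set h : ℝ := 1 / (2 * s : ℝ) with hh
  have hsh : 2 * (s : ℝ) * h = 1 := by rw [hh]; field_simp
  induction i using Nat.twoStepInduction with
  | zero =>
    rw [hypSum_zero, Real.cosh_eq]
    simp [padeDen, padeNum, padeSeq]
    ring
  | one =>
    have := hypSum_one h
    rw [Real.sinh_eq] at this
    simp [padeDen, padeNum, padeSeq]
    linarith
  | more i h0 h1 =>
    have hr := hypSum_rec h i
    rw [padeDen_succ_succ, padeNum_succ_succ]
    push_cast
    have : (-1 : ℝ) ^ (i + 2 + 1) * (2 * h ^ (i + 2) * hypSum h (i + 2))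
        = (-1) ^ (i + 1) * (2 * h ^ i * (h ^ 2 * hypSum h (i + 2))) := by ring
    rw [this, hr]
    linear_combination h0 + (4 * (i : ℝ) + 2) * s * h1
      + ((-1) ^ (i + 1 + 1) * 2 * h ^ i * hypSum h (i + 1)) * (2 * i + 1) * hsh

lemma pade_alternating {s : ℕ} (hs : 1 ≤ s) (i : ℕ) :
    0 < (-1) ^ (i + 1) * (padeDen s i * Real.exp (1 / (s : ℝ)) - padeNum s i) := by
  have hs' : (0 : ℝ) < s := by exact_mod_cast hs
  have h := pade_remainder hs i
  have hp := hypSum_pos (1 / (2 * s : ℝ)) i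
  have he : padeDen s i * Real.exp (1 / (s : ℝ)) - padeNum s i
      = Real.exp (1 / (2 * s : ℝ)) * (padeDen s i * Real.exp (1 / (2 * s : ℝ))
        - padeNum s i * Real.exp (-(1 / (2 * s : ℝ)))) := by
    have e1 : Real.exp (1 / (s : ℝ)) = Real.exp (1 / (2 * s : ℝ)) * Real.exp (1 / (2 * s : ℝ)) := by
      rw [← Real.exp_add]; congr 1; field_simp; norm_num
    have e2 : Real.exp (1 / (2 * s : ℝ)) * Real.exp (-(1 / (2 * s : ℝ))) = 1 := by
      rw [← Real.exp_add]; simp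
    rw [e1]
    linear_combination (padeNum s i : ℝ) * e2
  rw [he, h]
  have hsq : ((-1 : ℝ) ^ (i + 1)) * (-1) ^ (i + 1) = 1 := by rw [← mul_pow]; simp
  have : (-1 : ℝ) ^ (i + 1) * (Real.exp (1 / (2 * s : ℝ)) * ((-1) ^ (i + 1)
      * (2 * (1 / (2 * s : ℝ)) ^ i * hypSum (1 / (2 * s : ℝ)) i)))
      = Real.exp (1 / (2 * s : ℝ)) * (2 * (1 / (2 * s : ℝ)) ^ i * hypSum (1 / (2 * s : ℝ)) i) := by
    linear_combination (Real.exp (1 / (2 * s : ℝ))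
      * (2 * (1 / (2 * s : ℝ)) ^ i * hypSum (1 / (2 * s : ℝ)) i)) * hsq
  rw [this]
  positivity

/-- Consecutive errors have opposite signs, so the determinant identity reads `q_{i+2} |x| + q_{i+1}
|y| = 2`. -/
lemma pade_error {s : ℕ} (hs : 1 ≤ s) (i : ℕ) :
    (padeDen s (i + 2) : ℝ)
      * |padeDen s (i + 1) * Real.exp (1 / (s : ℝ)) - padeNum s (i + 1)| ≤ 2 := by
  have a0 := pade_alternating hs (i + 1)
  have a1 := pade_alternating hs (i + 2)
  have d0 : (1 : ℝ) ≤ padeDen s (i + 1) := by exact_mod_cast padeDen_pos hs i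
  have d1 : (1 : ℝ) ≤ padeDen s (i + 2) := by exact_mod_cast padeDen_pos hs (i + 1)
  have hd : (padeDen s (i + 2) * padeNum s (i + 1) - padeDen s (i + 1) * padeNum s (i + 2) : ℝ)
      = 2 * (-1) ^ (i + 1) := by exact_mod_cast pade_det s (i + 1)
  set x := padeDen s (i + 1) * Real.exp (1 / (s : ℝ)) - padeNum s (i + 1) with hx
  set y := padeDen s (i + 2) * Real.exp (1 / (s : ℝ)) - padeNum s (i + 2) with hy
  have hxy : padeDen s (i + 2) * x - padeDen s (i + 1) * y = -(2 * (-1) ^ (i + 1)) := by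
    rw [← hd, hx, hy]; ring
  have habs : |x| = (-1) ^ (i + 1 + 1) * x := by
    rw [← abs_of_pos a0, abs_mul]; simp
  have hsq : ((-1 : ℝ) ^ (i + 1)) * (-1) ^ (i + 1) = 1 := by rw [← mul_pow]; simp
  have hnn : 0 ≤ padeDen s (i + 1) * ((-1) ^ (i + 2 + 1) * y) := by positivity
  have : (padeDen s (i + 2) : ℝ) * ((-1) ^ (i + 1 + 1) * x)
      = 2 - padeDen s (i + 1) * ((-1) ^ (i + 2 + 1) * y) := by
    linear_combination (-(-1 : ℝ) ^ (i + 1)) * hxy + 2 * hsq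
  rw [habs, this]
  linarith

lemma eq_mul_pade_of_good_approx {s : ℕ} (hs : 1 ≤ s) {P Q : ℤ} (hQ : Q ≠ 0)
    (h : |(Q : ℝ)| * |Q * Real.exp (1 / (s : ℝ)) - P| ≤ 1 / 16) :
    ∃ (i : ℕ) (k : ℤ), P = k * padeNum s i ∧ Q = k * padeDen s i := by
  classical
  have hQ1 : 1 ≤ |Q| := Int.one_le_abs hQ
  have hex : ∃ j, 4 * |Q| < padeDen s (j + 1) := by
    refine ⟨(4 * |Q|).toNat + 2, ?_⟩
    have := padeDen_large hs (4 * |Q|).toNat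
    have h2 := Int.self_le_toNat (4 * |Q|)
    have : padeDen s ((4 * |Q|).toNat + 2 + 1) = padeDen s ((4 * |Q|).toNat + 3) := rfl
    omega
  obtain ⟨i, hi⟩ : ∃ i, Nat.find hex = i + 1 := by
    refine Nat.exists_eq_succ_of_ne_zero fun h0 => ?_
    have := Nat.find_spec hex
    rw [h0] at this
    simp [padeDen, padeSeq] at this
    omega
  -- Choosing `q_{i+1} ≤ 4|Q| < q_{i+2}` bounds the integer `P q_{i+1} - p_{i+1} Q` by 2/4 + 4/16 <
  -- 1, so it is zero.
  have hbig : 4 * |Q| < padeDen s (i + 2) := by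
    have := Nat.find_spec hex; rwa [hi] at this
  have hsmall : padeDen s (i + 1) ≤ 4 * |Q| := not_lt.1 (Nat.find_min hex (by omega))
  have hpos := padeDen_pos hs i
  have herr := pade_error hs i
  have hbig' : 4 * |(Q : ℝ)| < padeDen s (i + 2) := by exact_mod_cast hbig
  have hsmall' : (padeDen s (i + 1) : ℝ) ≤ 4 * |(Q : ℝ)| := by exact_mod_cast hsmall
  have hpos' : (1 : ℝ) ≤ padeDen s (i + 1) := by exact_mod_cast hpos
  set θ := Real.exp (1 / (s : ℝ))
  have hdet : P * padeDen s (i + 1) = padeNum s (i + 1) * Q := by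
    have hlt : |((P * padeDen s (i + 1) - padeNum s (i + 1) * Q : ℤ) : ℝ)| < 1 := by
      have e : ((P * padeDen s (i + 1) - padeNum s (i + 1) * Q : ℤ) : ℝ)
          = Q * (padeDen s (i + 1) * θ - padeNum s (i + 1))
            - padeDen s (i + 1) * (Q * θ - P) := by push_cast; ring
      rw [e]
      refine lt_of_le_of_lt (abs_sub _ _) ?_
      rw [abs_mul, abs_mul, abs_of_pos (by linarith : (0 : ℝ) < padeDen s (i + 1))]
      have b1 := mul_le_mul_of_nonneg_right hbig'.le
        (abs_nonneg (padeDen s (i + 1) * θ - padeNum s (i + 1)))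
      have b2 := mul_le_mul_of_nonneg_right hsmall' (abs_nonneg (Q * θ - P))
      linarith
    have : |P * padeDen s (i + 1) - padeNum s (i + 1) * Q| < 1 := by exact_mod_cast hlt
    linarith [Int.abs_lt_one_iff.1 this]
  obtain ⟨k, hk⟩ : padeDen s (i + 1) ∣ Q :=
    (pade_isCoprime s (i + 1)).dvd_of_dvd_mul_left ⟨P, by linarith⟩
  refine ⟨i + 1, k, ?_, by rw [hk]; ring⟩
  have h0 : padeDen s (i + 1) ≠ 0 := by omega
  apply mul_right_cancel₀ h0
  rw [hdet, hk]; ring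

/-! ### The inhomogeneous constant -/

lemma distNearestInt_nonneg (x : ℝ) : 0 ≤ distNearestInt x := abs_nonneg _

lemma inhomApproxConst_eq_zero_iff (θ φ : ℝ) :
    inhomApproxConst θ φ = 0 ↔ ∀ ε : ℝ, 0 < ε → ∀ B : ℤ, ∃ q : ℤ, B ≤ |q| ∧
      |(q : ℝ)| * distNearestInt (q * θ - φ) < ε := by
  have hfreq : ∀ p : ℤ → Prop, (∃ᶠ q in comap (fun q : ℤ => |q|) atTop, p q) ↔
      ∀ B : ℤ, ∃ q : ℤ, B ≤ |q| ∧ p q := by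
    intro p
    rw [(atTop_basis.comap _).frequently_iff]
    simp
  constructor
  · intro h ε hε B
    have hlt : inhomApproxConst θ φ < (ε : EReal) := by rw [h]; exact_mod_cast hε
    have := (hfreq _).1 (frequently_lt_of_liminf_lt (by isBoundedDefault) hlt) B
    simpa only [EReal.coe_lt_coe_iff] using this
  · intro h
    refine le_antisymm ?_ ?_
    · refine le_of_forall_gt fun c hc => ?_
      obtain ⟨ε, hε, hεc⟩ := EReal.lt_iff_exists_real_btwn.1 hc
      have hε' : 0 < ε := by exact_mod_cast hε
      refine lt_of_le_of_lt (liminf_le_of_frequently_le ((hfreq _).2 fun B => ?_)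
        (by isBoundedDefault)) hεc
      obtain ⟨q, hq, hlt⟩ := h ε hε' B
      exact ⟨q, hq, by exact_mod_cast hlt.le⟩
    · refine le_liminf_of_le (by isBoundedDefault) (Eventually.of_forall fun q => ?_)
      exact EReal.coe_nonneg.2 (mul_nonneg (abs_nonneg _) (distNearestInt_nonneg _))

lemma exists_good_approx_of_inhomApproxConst_eq_zero {θ : ℝ} {n : ℕ} (hn : 1 ≤ n) {m r : ℤ}
    (h : inhomApproxConst θ ((m + r * θ) / n) = 0) {ε : ℝ} (hε : 0 < ε) :
    ∃ P Q : ℤ, Q ≠ 0 ∧ (P : ZMod n) = m ∧ (Q : ZMod n) = -r ∧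
      |(Q : ℝ)| * |Q * θ - P| ≤ ε := by
  have hn' : (1 : ℝ) ≤ n := by exact_mod_cast hn
  have hC : 0 < n * (n + |(r : ℝ)|) := by positivity
  -- `|q| > |r|` keeps `Q = nq - r` nonzero; the divisor absorbs `|Q| ≤ (n + |r|)|q|` and the factor
  -- `n` in `Qθ - P`.
  obtain ⟨q, hqB, hq⟩ := (inhomApproxConst_eq_zero_iff _ _).1 h (ε / (n * (n + |(r : ℝ)|)))
    (by positivity) (|r| + 1)
  set p := round ((q : ℝ) * θ - (m + r * θ) / n)
  have hqr : (1 : ℝ) ≤ |(q : ℝ)| := by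
    have : 1 ≤ |q| := by linarith [abs_nonneg r]
    exact_mod_cast this
  refine ⟨n * p + m, n * q - r, ?_, by simp, by simp, ?_⟩
  · intro h0
    have hle : |q| ≤ |r| := by
      rw [← sub_eq_zero.1 h0, abs_mul]
      have : (1 : ℤ) ≤ |(n : ℤ)| := by simpa using hn
      nlinarith [abs_nonneg q]
    linarith
  · have e : (((n * q - r : ℤ) : ℝ) * θ - ((n * p + m : ℤ) : ℝ))
        = n * ((q : ℝ) * θ - (m + r * θ) / n - p) := by
      push_cast; field_simp; ring
    have hQ : |((n * q - r : ℤ) : ℝ)| ≤ (n + |(r : ℝ)|) * |(q : ℝ)| := by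
      push_cast
      refine (abs_sub _ _).trans ?_
      rw [abs_mul, Nat.abs_cast]
      nlinarith [abs_nonneg (r : ℝ)]
    rw [lt_div_iff₀ hC, distNearestInt] at hq
    rw [e, abs_mul, Nat.abs_cast]
    have := mul_le_mul_of_nonneg_right hQ
      (by positivity : 0 ≤ n * |(q : ℝ) * θ - (m + r * θ) / n - p|)
    nlinarith

lemma inhomApproxConst_eq_zero_of_good_approx {θ : ℝ} {n : ℕ} (hn : 1 ≤ n) {m r : ℤ}
    (h : ∀ ε : ℝ, 0 < ε → ∀ B : ℤ, ∃ P Q : ℤ, B ≤ |Q| ∧ (P : ZMod n) = m ∧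
      (Q : ZMod n) = r ∧ |(Q : ℝ)| * |Q * θ - P| < ε) :
    inhomApproxConst θ ((m - r * θ) / n) = 0 := by
  have hn' : (1 : ℝ) ≤ n := by exact_mod_cast hn
  rw [inhomApproxConst_eq_zero_iff]
  intro ε hε B
  obtain ⟨P, Q, hB, hP, hQ, hlt⟩ := h (ε / (1 + |(r : ℝ)|)) (by positivity)
    (n * |B| + |r| + 1)
  obtain ⟨p, hp⟩ := (ZMod.intCast_eq_intCast_iff_dvd_sub m P n).1 hP.symm
  obtain ⟨q, hq⟩ := (ZMod.intCast_eq_intCast_iff_dvd_sub r Q n).1 hQ.symm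
  obtain rfl : P = n * p + m := by linarith
  obtain rfl : Q = n * q + r := by linarith
  refine ⟨q, ?_, ?_⟩
  · have h1 : |(n : ℤ) * q + r| ≤ n * |q| + |r| := by
      refine (abs_add_le _ _).trans ?_
      rw [abs_mul, Nat.abs_cast]
    have hn'' : (0 : ℤ) < n := by exact_mod_cast hn
    have h2 : (n : ℤ) * |B| < n * |q| := by linarith
    exact (le_abs_self B).trans (lt_of_mul_lt_mul_left h2 hn''.le).le
  · have hQ1 : (1 : ℝ) ≤ |((n * q + r : ℤ) : ℝ)| := by
      have : (1 : ℤ) ≤ |(n * q + r : ℤ)| := by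
        have : 0 ≤ (n : ℤ) * |B| := by positivity
        linarith [abs_nonneg r]
      exact_mod_cast this
    have hd : distNearestInt (q * θ - (m - r * θ) / n)
        ≤ |((n * q + r : ℤ) : ℝ) * θ - ((n * p + m : ℤ) : ℝ)| / n := by
      refine (round_le _ p).trans (le_of_eq ?_)
      rw [← abs_of_pos (by linarith : (0 : ℝ) < n), ← abs_div, abs_of_pos (by linarith : (0 : ℝ) < n)]
      congr 1
      push_cast; field_simp; ring
    have hqn : |(q : ℝ)| * 1 ≤ (1 + |(r : ℝ)|) * |((n * q + r : ℤ) : ℝ)| := by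
      have h1 : n * |(q : ℝ)| ≤ |((n * q + r : ℤ) : ℝ)| + |(r : ℝ)| := by
        have e : (n : ℝ) * q = ((n * q + r : ℤ) : ℝ) - r := by push_cast; ring
        rw [← abs_of_pos (by linarith : (0 : ℝ) < n), ← abs_mul, e]
        exact abs_sub _ _
      nlinarith [abs_nonneg (r : ℝ), abs_nonneg (q : ℝ)]
    rw [lt_div_iff₀ (by positivity)] at hlt
    have hd' := hd.trans (div_le_self (abs_nonneg _) hn')
    have := mul_le_mul hqn hd' (distNearestInt_nonneg _) (by positivity)
    nlinarith

theorem corollary10 (s n : ℕ) (hs : 1 ≤ s) (hn : 2 ≤ n) (m r : ℤ)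
    (h : inhomApproxConst (Real.exp (1 / (s : ℝ)))
      (((m : ℝ) + (r : ℝ) * Real.exp (1 / (s : ℝ))) / (n : ℝ)) = 0) :
    inhomApproxConst (Real.exp (1 / (s : ℝ)))
      (((m : ℝ) - (r : ℝ) * Real.exp (1 / (s : ℝ))) / (n : ℝ)) = 0 := by
  have : NeZero n := ⟨by omega⟩
  obtain ⟨P, Q, hQ0, hP, hQ, hlt⟩ := exists_good_approx_of_inhomApproxConst_eq_zero (by omega) h
    (by norm_num : (0 : ℝ) < 1 / 16)
  obtain ⟨i, k, rfl, rfl⟩ := eq_mul_pade_of_good_approx hs hQ0 hlt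
  have hk : k ≠ 0 := left_ne_zero_of_mul hQ0
  refine inhomApproxConst_eq_zero_of_good_approx (by omega) fun ε hε B => ?_
  -- The value at `k (p_{j+3}, q_{j+3})` is at most `2k² / (j + 2)`, with `k` fixed and `j ≥ N`.
  obtain ⟨N, hN⟩ := exists_nat_gt (2 * (k : ℝ) ^ 2 / ε)
  obtain ⟨l, hl, hlp, hlq⟩ := exists_pade_reflect n s i (N + B.toNat + 3)
  obtain ⟨j, rfl⟩ : ∃ j, l = j + 3 := ⟨l - 3, by omega⟩
  have hden := padeDen_large hs j
  refine ⟨k * padeNum s (j + 3), k * padeDen s (j + 3), ?_, ?_, ?_, ?_⟩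
  · rw [abs_mul, abs_of_pos (by linarith : 0 < padeDen s (j + 3))]
    have h1 := Int.one_le_abs hk
    have h2 := Int.self_le_toNat B
    have h3 : (B.toNat : ℤ) ≤ j := by omega
    nlinarith
  · rw [← hP]; push_cast; rw [hlp]
  · push_cast at hQ ⊢
    rw [hlq, mul_neg, hQ, neg_neg]
  · have herr := pade_error hs (j + 2)
    have hg : ((j + 2 : ℝ)) * padeDen s (j + 3) ≤ padeDen s (j + 4) := by
      have := padeDen_growth hs (j + 1)
      push_cast at this
      have h' : ((j : ℤ) + 2) * padeDen s (j + 3) ≤ padeDen s (j + 4) := by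
        convert this using 2; ring
      exact_mod_cast h'
    have hd0 : (0 : ℝ) < padeDen s (j + 3) := by
      exact_mod_cast (by linarith : 0 < padeDen s (j + 3))
    push_cast
    set x := padeDen s (j + 3) * Real.exp (1 / (s : ℝ)) - padeNum s (j + 3) with hx
    have e : (k : ℝ) * padeDen s (j + 3) * Real.exp (1 / (s : ℝ)) - k * padeNum s (j + 3)
        = k * x := by rw [hx]; ring
    rw [e, abs_mul, abs_mul, abs_of_pos hd0]
    have h1 : ((j + 2 : ℝ)) * (padeDen s (j + 3) * |x|) ≤ 2 := by
      have := mul_le_mul_of_nonneg_right hg (abs_nonneg x)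
      have h2 : (padeDen s (j + 4) : ℝ) * |x| ≤ 2 := herr
      linarith
    have hNj : (N : ℝ) ≤ j := by exact_mod_cast (by omega : N ≤ j)
    rw [div_lt_iff₀ hε] at hN
    have hk2 : (0 : ℝ) < (k : ℝ) ^ 2 := by positivity
    have h3 : |(k : ℝ)| * padeDen s (j + 3) * (|(k : ℝ)| * |x|)
        = (k : ℝ) ^ 2 * (padeDen s (j + 3) * |x|) := by
      rw [← sq_abs (k : ℝ)]; ring
    rw [h3]
    have h4 : (k : ℝ) ^ 2 * (((j + 2 : ℝ)) * (padeDen s (j + 3) * |x|)) ≤ (k : ℝ) ^ 2 * 2 :=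
      mul_le_mul_of_nonneg_left h1 hk2.le
    have h5 : (j + 2 : ℝ) * ((k : ℝ) ^ 2 * (padeDen s (j + 3) * |x|)) < (j + 2) * ε := by
      nlinarith
    exact lt_of_mul_lt_mul_left h5 (by positivity)
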